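/- Let $h,k\ge 1$ and $\nu\in(0,1)$, and let $c_{ij}>0$ ($1\le i\le h$, $1\le j\le k$) be constants. Let $S_1,\dots,S_h$ be real-valued Lévy processes such that the functions $\kappa_{S_i}(\theta):=\log\mathbb{E}[e^{\theta S_i(1)}]$ are finite in a neighbourhood of $\theta=0$, and put $m=(m_1,\dots,m_h):=(\kappa_{S_1}'(0),\dots,\kappa_{S_h}'(0))$. Let $L_1^\nu,\dots,L_k^\nu$ be inverse stable subordinators of parameter $\nu$, i.e. $L_j^\nu(t)=\inf\{s\ge 0: D_j(s)>t\}$ for a stable subordinator $D_j$ of order $\nu$ (a nondecreasing Lévy process with $\mathbb{E}[e^{\theta D_j(t)}]=e^{-t(-\theta)^\nu}$ for all $\theta\le 0$ and $t\ge 0$). Assume that the $h+k$ processes $S_1,\dots,S_h,L_1^\nu,\dots,L_k^\nu$ are independent. Let $\alpha_m(\nu):=1-\nu/2$ if $m=0$ and $\alpha_m(\nu):=1-\nu$ if $m\ne 0$. Then the random vectors $$\left(t^{\alpha_m(\nu)}\,\frac{S_i\big(\sum_{j=1}^k c_{ij}L_j^\nu(t)\big)}{t}\right)_{i\in\{1,\dots,h\}}$$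 converge weakly as $t\to\infty$. More precisely: - if $m=0$, they converge weakly to $\Big(\sqrt{\sum_{j=1}^k c_{ij}L_j^\nu(1)\,\kappa_{S_i}''(0)}\;Z_i\Big)_{i\in\{1,\dots,h\}}$, where $Z_1,\dots,Z_h$ are independent standard normal random variables, independent of $L_1^\nu,\dots,L_k^\nu$ and $S_1,\dots,S_h$; - if $m\ne 0$, they converge weakly to $\Big(m_i\sum_{j=1}^k c_{ij}L_j^\nu(1)\Big)_{i\in\{1,\dots,h\}}$. -/

import Mathlib

open MeasureTheory ProbabilityTheory Filter Topology
open scoped NNReal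

/-- A real-valued Lévy process `X = {X(t) : t ≥ 0}` on `(Ω, P)`: it starts at `0`, has independent
and stationary increments, and almost every path is right-continuous with left limits
(stochastic continuity follows from these properties). -/
structure IsLevyProcess {Ω : Type*} [MeasurableSpace Ω] (X : ℝ≥0 → Ω → ℝ) (P : Measure Ω) :
    Prop where
  measurable : ∀ t, Measurable (X t)
  zero : ∀ᵐ ω ∂P, X 0 ω = 0
  indep : HasIndepIncrements X P
  stationary : ∀ s t, IdentDistrib (fun ω ↦ X (s + t) ω - X s ω) (X t) P P
  cadlag : ∀ᵐ ω ∂P, ∀ t, ContinuousWithinAt (fun s ↦ X s ω) (Set.Ici t) t ∧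
    ∃ l, Tendsto (fun s ↦ X s ω) (𝓝[<] t) (𝓝 l)

/-- A real-valued random variable is light-tailed if its moment generating function is finite in a
neighbourhood of the origin. -/
def IsLightTailed {Ω : Type*} [MeasurableSpace Ω] (X : Ω → ℝ) (P : Measure Ω) : Prop :=
  ∀ᶠ θ in 𝓝 (0 : ℝ), Integrable (fun ω ↦ Real.exp (θ * X ω)) P

/-- A stable subordinator of order `ν`: a nondecreasing Lévy process `D` such that
`E[exp(θ D(t))] = exp(-t (-θ)^ν)` for all `θ ≤ 0` and `t ≥ 0`. -/
structure IsStableSubordinator {Ω : Type*} [MeasurableSpace Ω] (ν : ℝ) (D : ℝ≥0 → Ω → ℝ)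
    (P : Measure Ω) : Prop extends IsLevyProcess D P where
  monotone : ∀ᵐ ω ∂P, Monotone (fun t ↦ D t ω)
  laplace : ∀ (t : ℝ≥0) (θ : ℝ), θ ≤ 0 → mgf (D t) P θ = Real.exp (-(t * (-θ) ^ ν))

/-- An inverse stable subordinator of parameter `ν`: a process `L` such that, for some stable
subordinator `D` of order `ν`, `L(t) = inf {s ≥ 0 : D(s) > t}` for all `t ≥ 0`, almost surely. -/
structure IsInverseStableSubordinator {Ω : Type*} [MeasurableSpace Ω] (ν : ℝ)
    (L : ℝ≥0 → Ω → ℝ≥0) (P : Measure Ω) : Prop where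
  measurable : ∀ t, Measurable (L t)
  exists_eq_sInf : ∃ D : ℝ≥0 → Ω → ℝ, IsStableSubordinator ν D P ∧
    ∀ᵐ ω ∂P, ∀ t, L t ω = sInf {s : ℝ≥0 | (t : ℝ) < D s ω}

/-- The function `κ_X(θ) = log E[exp(θ X(1))]` of a process `X`. -/
noncomputable def kappa {Ω : Type*} [MeasurableSpace Ω] (X : ℝ≥0 → Ω → ℝ) (P : Measure Ω) :
    ℝ → ℝ :=
  fun θ ↦ Real.log (∫ ω, Real.exp (θ * X 1 ω) ∂P)

/-- The vector `m = (κ_{S_1}'(0), …, κ_{S_h}'(0))`. -/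
noncomputable def driftVector {Ω : Type*} [MeasurableSpace Ω] {h : ℕ}
    (S : Fin h → ℝ≥0 → Ω → ℝ) (P : Measure Ω) : Fin h → ℝ :=
  fun i ↦ deriv (kappa (S i) P) 0

open Classical in
/-- The exponent `α_m(ν)`, equal to `1 - ν / 2` if `m = 0` and to `1 - ν` if `m ≠ 0`. -/
noncomputable def alphaExponent {h : ℕ} (m : Fin h → ℝ) (ν : ℝ) : ℝ :=
  if m = 0 then 1 - ν / 2 else 1 - ν

/-- The vector `(t^α S_i(∑_j c_{ij} L_j(t)) / t)_i`. -/
noncomputable def scaledTimeChange {Ω : Type*} {h k : ℕ} (S : Fin h → ℝ≥0 → Ω → ℝ)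
    (L : Fin k → ℝ≥0 → Ω → ℝ≥0) (c : Fin h → Fin k → ℝ≥0) (α : ℝ) (t : ℝ≥0) (ω : Ω) :
    EuclideanSpace ℝ (Fin h) :=
  WithLp.toLp 2 fun i ↦ (t : ℝ) ^ α * (S i (∑ j, c i j * L j t ω) ω / t)

/-! Everything is done with characteristic functions. The random times are independent of the `S i`,
so conditioning on them turns the characteristic function of the scaled vector into the expectation
of a product of characteristic functions of the `S i` at fixed times
(`IsLevyProcess.integral_prod_exp_timeChange`). Only the joint law of the `L j t` at one time `t`
now matters, and by self-similarity it is that of `t ^ ν * L j 1`.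

With `T = t ^ ν` the factor `t ^ α / t` is `T ^ β`, where `β = (α - 1) / ν` is `-1/2` if `m = 0` and
`-1` otherwise. What is left is the central limit theorem, respectively the law of large numbers,
for each `S i` at a deterministic time `T * s`: if `φ` is the characteristic function of `S i 1`,
then `φ (T ^ β * x) ^ (T * s)` tends to `exp (s * w)`, with `w` read off the Taylor expansion of `φ`
at `0` (`IsLevyProcess.tendsto_charFun_map_mul`). All integrands have modulus at most one, so the
limit passes under the expectation over the `L j 1`, and Lévy's continuity theorem concludes. -/

/-- If `g → 0` and `n * g → w`, then `(1 + g) ^ n → exp w`. -/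
lemma Complex.tendsto_one_add_pow_exp_of_tendsto_mul {ι : Type*} {l : Filter ι} {g : ι → ℂ}
    {n : ι → ℕ} {w : ℂ} (hg : Tendsto g l (𝓝 0)) (hng : Tendsto (fun i ↦ n i * g i) l (𝓝 w)) :
    Tendsto (fun i ↦ (1 + g i) ^ n i) l (𝓝 (Complex.exp w)) := by
  have hlog : (fun z : ℂ ↦ Complex.log (1 + z) - z) =o[𝓝 0] fun z ↦ z := by
    have h := ((Complex.hasDerivAt_log (z := 1 + 0) (by simp)).comp_const_add 1 0).isLittleO
    simpa using h
  have h1 : Tendsto (fun i ↦ n i * (Complex.log (1 + g i) - g i)) l (𝓝 0) :=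
    ((Asymptotics.isBigO_refl (fun i ↦ (n i : ℂ)) l).mul_isLittleO
      (hlog.comp_tendsto hg)).trans_isBigO (hng.isBigO_one ℂ) |>.tendsto_zero_of_tendsto
      tendsto_const_nhds
  have h2 : Tendsto (fun i ↦ n i * Complex.log (1 + g i)) l (𝓝 w) := by
    simpa [mul_sub] using h1.add hng
  refine ((Complex.continuous_exp.tendsto w).comp h2).congr' ?_
  have hne : ∀ᶠ i in l, 1 + g i ≠ 0 := by
    have : Tendsto (fun i ↦ 1 + g i) l (𝓝 1) := by simpa using hg.const_add 1
    exact this.eventually_ne one_ne_zero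
  filter_upwards [hne] with i hi
  simp only [Function.comp_apply]
  rw [Complex.exp_nat_mul, Complex.exp_log hi]

/-! ### Laplace transforms of nonnegative variables -/

namespace ProbabilityTheory

variable {Ω Ω' : Type*} {mΩ : MeasurableSpace Ω} {mΩ' : MeasurableSpace Ω'} {P : Measure Ω}
  {P' : Measure Ω'}

/-- Carries identities from the open left half-plane, where the transform is analytic, to the
imaginary axis, where it is the characteristic function. -/
lemma tendsto_complexMGF_nhdsLT_zero [IsFiniteMeasure P] {X : Ω → ℝ} (hX : AEMeasurable X P)
    (hX0 : ∀ᵐ ω ∂P, 0 ≤ X ω) (y : ℝ) :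
    Tendsto (fun x : ℝ ↦ complexMGF X P (x + y * Complex.I)) (𝓝[<] 0)
      (𝓝 (complexMGF X P (y * Complex.I))) := by
  refine tendsto_integral_filter_of_dominated_convergence (fun _ ↦ 1) ?_ ?_ (integrable_const _) ?_
  · exact .of_forall fun x ↦ by fun_prop
  · filter_upwards [self_mem_nhdsWithin] with x hx
    filter_upwards [hX0] with ω hω
    rw [Complex.norm_exp]
    simpa using mul_nonpos_of_nonpos_of_nonneg (le_of_lt hx) hω
  · refine .of_forall fun ω ↦ ?_
    have : Continuous fun x : ℝ ↦ Complex.exp ((x + y * Complex.I) * X ω) := by fun_prop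
    simpa using (this.tendsto 0).mono_left nhdsWithin_le_nhds

lemma Iio_subset_interior_integrableExpSet [IsFiniteMeasure P] {X : Ω → ℝ}
    (hX : AEMeasurable X P) (hX0 : ∀ᵐ ω ∂P, 0 ≤ X ω) :
    Set.Iio 0 ⊆ interior (integrableExpSet X P) := by
  refine interior_maximal (fun x hx ↦ ?_) isOpen_Iio
  refine Integrable.of_bound (by fun_prop) 1 ?_
  filter_upwards [hX0] with ω hω
  simpa using mul_nonpos_of_nonpos_of_nonneg (le_of_lt hx) hω

/-- **Uniqueness of Laplace transforms**: the laws of two nonnegative random variables agree if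
their moment generating functions agree on the negative half-line. -/
theorem map_eq_of_mgf_eqOn_nonpos [IsProbabilityMeasure P] [IsProbabilityMeasure P']
    {X : Ω → ℝ} {Y : Ω' → ℝ} (hX : AEMeasurable X P) (hY : AEMeasurable Y P')
    (hX0 : ∀ᵐ ω ∂P, 0 ≤ X ω) (hY0 : ∀ᵐ ω ∂P', 0 ≤ Y ω)
    (h : ∀ θ ≤ 0, mgf X P θ = mgf Y P' θ) : P.map X = P'.map Y := by
  have hXan : AnalyticOnNhd ℂ (complexMGF X P) {z | z.re < 0} :=
    analyticOnNhd_complexMGF.mono fun z hz ↦ Iio_subset_interior_integrableExpSet hX hX0 hz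
  have hYan : AnalyticOnNhd ℂ (complexMGF Y P') {z | z.re < 0} :=
    analyticOnNhd_complexMGF.mono fun z hz ↦ Iio_subset_interior_integrableExpSet hY hY0 hz
  -- Identity theorem: the hypothesis gives equality at the real points accumulating at `-1`.
  have heq : Set.EqOn (complexMGF X P) (complexMGF Y P') {z | z.re < 0} := by
    refine AnalyticOnNhd.eqOn_of_preconnected_of_frequently_eq hXan hYan
      (convex_halfSpace_re_lt 0).isPreconnected (z₀ := ((-1 : ℝ) : ℂ)) (by simp) ?_
    have h_real : ∃ᶠ x : ℝ in 𝓝[≠] (-1), complexMGF X P x = complexMGF Y P' x := by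
      refine Eventually.frequently ?_
      filter_upwards [nhdsWithin_le_nhds (Iio_mem_nhds (show (-1 : ℝ) < 0 by norm_num))] with x hx
      rw [complexMGF_ofReal, complexMGF_ofReal, h x (le_of_lt hx)]
    rw [frequently_iff_seq_forall] at h_real ⊢
    obtain ⟨xs, hx, hx_eq⟩ := h_real
    refine ⟨fun n ↦ xs n, ?_, hx_eq⟩
    rw [tendsto_nhdsWithin_iff] at hx ⊢
    refine ⟨(Complex.continuous_ofReal.tendsto _).comp hx.1, ?_⟩
    filter_upwards [hx.2] with n hn hn'
    exact hn (Complex.ofReal_injective hn')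
  have hI (y : ℝ) : complexMGF X P (y * Complex.I) = complexMGF Y P' (y * Complex.I) := by
    refine tendsto_nhds_unique ((tendsto_complexMGF_nhdsLT_zero hX hX0 y).congr' ?_)
      (tendsto_complexMGF_nhdsLT_zero hY hY0 y)
    filter_upwards [self_mem_nhdsWithin] with x hx
    exact heq (by simpa using hx)
  have := Measure.isProbabilityMeasure_map (μ := P) hX
  have := Measure.isProbabilityMeasure_map (μ := P') hY
  refine Measure.ext_of_charFun (funext fun y ↦ ?_)
  rw [← complexMGF_mul_I hX, ← complexMGF_mul_I hY, hI]

end ProbabilityTheory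

/-! ### Characteristic functions of Lévy processes -/

/-- A function on `ℝ≥0` with right and left limits is bounded on compact intervals. -/
lemma exists_abs_le_of_cadlag {f : ℝ≥0 → ℝ} (hf : ∀ t, ContinuousWithinAt f (Set.Ici t) t ∧
    ∃ l, Tendsto f (𝓝[<] t) (𝓝 l)) (b : ℝ≥0) : ∃ C, ∀ r ≤ b, |f r| ≤ C := by
  suffices ∃ C, ∀ r ∈ Set.Icc 0 b, |f r| ≤ C by simpa using this
  refine isCompact_Icc.induction_on (p := fun s ↦ ∃ C, ∀ r ∈ s, |f r| ≤ C) ⟨0, by simp⟩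
    (fun s t hst ⟨C, hC⟩ ↦ ⟨C, fun r hr ↦ hC r (hst hr)⟩) ?_ ?_
  · rintro s t ⟨C, hC⟩ ⟨C', hC'⟩
    refine ⟨max C C', ?_⟩
    rintro r (hr | hr)
    · exact le_max_of_le_left (hC r hr)
    · exact le_max_of_le_right (hC' r hr)
  · intro t _
    obtain ⟨hr, l, hl⟩ := hf t
    have h1 : ∀ᶠ r in 𝓝[<] t, |f r| ≤ |l| + 1 :=
      (hl.abs.eventually (gt_mem_nhds (lt_add_one _))).mono fun _ h ↦ h.le
    have h2 : ∀ᶠ r in 𝓝[≥] t, |f r| ≤ |f t| + 1 :=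
      ((hr.tendsto.abs).eventually (gt_mem_nhds (lt_add_one _))).mono fun _ h ↦ h.le
    refine ⟨{r | |f r| ≤ max (|l| + 1) (|f t| + 1)}, mem_nhdsWithin_of_mem_nhds ?_,
      _, fun _ h ↦ h⟩
    rw [← nhdsLT_sup_nhdsGE]
    exact ⟨h1.mono fun _ h ↦ le_max_of_le_left h, h2.mono fun _ h ↦ le_max_of_le_right h⟩

namespace IsLevyProcess

variable {Ω : Type*} {mΩ : MeasurableSpace Ω} {P : Measure Ω} {X : ℝ≥0 → Ω → ℝ}

lemma charFun_map_apply (hX : IsLevyProcess X P) (u : ℝ≥0) (x : ℝ) :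
    charFun (P.map (X u)) x = ∫ ω, Complex.exp (x * X u ω * Complex.I) ∂P := by
  rw [charFun_apply_real, integral_map (hX.measurable u).aemeasurable (by fun_prop)]

variable [IsProbabilityMeasure P]

lemma charFun_map_zero (hX : IsLevyProcess X P) (x : ℝ) : charFun (P.map (X 0)) x = 1 := by
  rw [Measure.map_congr (g := fun _ ↦ (0 : ℝ)) hX.zero]
  simp [charFun_apply]

lemma charFun_map_add (hX : IsLevyProcess X P) (u v : ℝ≥0) (x : ℝ) :
    charFun (P.map (X (u + v))) x = charFun (P.map (X u)) x * charFun (P.map (X v)) x := by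
  have hind : IndepFun (X u) (X (u + v) - X u) P :=
    hX.indep.indepFun_eval_sub zero_le le_self_add hX.zero
  have h := hind.charFun_map_add_eq_mul (hX.measurable _).aemeasurable
    ((hX.measurable _).sub (hX.measurable _)).aemeasurable
  rw [add_sub_cancel] at h
  rw [h, Pi.mul_apply, ← (hX.stationary u v).map_eq]
  rfl

lemma charFun_map_natCast (hX : IsLevyProcess X P) (n : ℕ) (x : ℝ) :
    charFun (P.map (X n)) x = charFun (P.map (X 1)) x ^ n := by
  induction n with
  | zero => simpa using hX.charFun_map_zero x
  | succ n ih => rw [Nat.cast_succ, hX.charFun_map_add, ih, pow_succ]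

/-- Almost every path is bounded on `[0, 1]`, so `a i * X (r i)` tends to `0` even though the times
`r i` need not converge. This disposes of fractional parts of large times. -/
lemma tendsto_charFun_map_of_le_one (hX : IsLevyProcess X P) {ι : Type*} {l : Filter ι}
    [l.IsCountablyGenerated] {r : ι → ℝ≥0} (hr : ∀ i, r i ≤ 1) {a : ι → ℝ}
    (ha : Tendsto a l (𝓝 0)) :
    Tendsto (fun i ↦ charFun (P.map (X (r i))) (a i)) l (𝓝 1) := by
  simp_rw [hX.charFun_map_apply]
  have h1 : (1 : ℂ) = ∫ _, 1 ∂P := by simp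
  rw [h1]
  refine tendsto_integral_filter_of_dominated_convergence (fun _ ↦ 1) ?_ ?_ (integrable_const _) ?_
  · refine .of_forall fun i ↦ ?_
    have := hX.measurable (r i)
    fun_prop
  · refine .of_forall fun i ↦ .of_forall fun ω ↦ ?_
    rw [← Complex.ofReal_mul, Complex.norm_exp_ofReal_mul_I]
  · filter_upwards [hX.cadlag] with ω hω
    obtain ⟨C, hC⟩ := exists_abs_le_of_cadlag hω 1
    have h0 : Tendsto (fun i ↦ a i * X (r i) ω) l (𝓝 0) := by
      refine squeeze_zero_norm (a := fun i ↦ |a i| * C) (fun i ↦ ?_) ?_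
      · rw [norm_mul]
        exact mul_le_mul_of_nonneg_left (hC _ (hr i)) (abs_nonneg _)
      · simpa using ha.abs.mul_const C
    have hc : Continuous fun y : ℝ ↦ Complex.exp (y * Complex.I) := by fun_prop
    simpa [Function.comp_def] using (hc.tendsto 0).comp h0

/-- If `T * (φ (a T) - 1) → w` for the characteristic function `φ` of a Lévy process at time `1`,
then the characteristic function at time `T * s`, taken at `a T`, converges to `exp (s * w)`. -/
lemma tendsto_charFun_map_mul (hX : IsLevyProcess X P) {a : ℝ≥0 → ℝ} {w : ℂ}
    (ha : Tendsto a atTop (𝓝 0))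
    (hw : Tendsto (fun T : ℝ≥0 ↦ ((T : ℝ) : ℂ) * (charFun (P.map (X 1)) (a T) - 1)) atTop (𝓝 w))
    (s : ℝ≥0) :
    Tendsto (fun T ↦ charFun (P.map (X (T * s))) (a T)) atTop (𝓝 (Complex.exp (s * w))) := by
  -- The integer part of the time gives a genuine power; the fractional part contributes a factor
  -- tending to `1`.
  have hdecomp (T : ℝ≥0) : charFun (P.map (X (T * s))) (a T) =
      (1 + (charFun (P.map (X 1)) (a T) - 1)) ^ ⌊T * s⌋₊ *
        charFun (P.map (X (T * s - ⌊T * s⌋₊))) (a T) := by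
    rw [add_sub_cancel, ← hX.charFun_map_natCast, ← hX.charFun_map_add,
      add_tsub_cancel_of_le (Nat.floor_le zero_le)]
  simp_rw [hdecomp]
  have hfrac := hX.tendsto_charFun_map_of_le_one (r := fun T : ℝ≥0 ↦ T * s - ⌊T * s⌋₊)
    (fun T ↦ by rw [tsub_le_iff_right, add_comm]; exact (Nat.lt_floor_add_one _).le) ha
  have hone := hX.tendsto_charFun_map_of_le_one (r := fun _ : ℝ≥0 ↦ 1) (fun _ ↦ le_rfl) ha
  have hg : Tendsto (fun T ↦ charFun (P.map (X 1)) (a T) - 1) atTop (𝓝 0) := by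
    simpa using hone.sub_const 1
  have hfl : Tendsto (fun T : ℝ≥0 ↦ (((T * s - ⌊T * s⌋₊ : ℝ≥0) : ℝ) : ℂ) *
      (charFun (P.map (X 1)) (a T) - 1)) atTop (𝓝 0) := by
    refine squeeze_zero_norm (fun T ↦ ?_) (by simpa using hg.norm)
    rw [norm_mul]
    refine mul_le_of_le_one_left (norm_nonneg _) ?_
    rw [Complex.norm_real, NNReal.norm_eq, NNReal.coe_le_one, tsub_le_iff_right, add_comm]
    exact (Nat.lt_floor_add_one _).le
  have hng : Tendsto (fun T : ℝ≥0 ↦ (⌊T * s⌋₊ : ℂ) * (charFun (P.map (X 1)) (a T) - 1)) atTop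
      (𝓝 (s * w)) := by
    have h := (hw.const_mul ((s : ℝ) : ℂ)).sub hfl
    rw [sub_zero] at h
    refine h.congr fun T ↦ ?_
    rw [NNReal.coe_sub (Nat.floor_le zero_le)]
    push_cast
    ring
  simpa using (Complex.tendsto_one_add_pow_exp_of_tendsto_mul hg hng).mul hfrac

end IsLevyProcess

/-! ### Taylor expansion of the characteristic function at zero -/

section MGF

variable {Ω : Type*} {mΩ : MeasurableSpace Ω} {P : Measure Ω} {X : ℝ≥0 → Ω → ℝ}

lemma kappa_eq_cgf (X : ℝ≥0 → Ω → ℝ) (P : Measure Ω) : kappa X P = cgf (X 1) P := rfl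

lemma IsLightTailed.zero_mem_interior {Y : Ω → ℝ} (hY : IsLightTailed Y P) :
    0 ∈ interior (integrableExpSet Y P) := mem_interior_iff_mem_nhds.2 hY

lemma IsLightTailed.memLp_map {Y : Ω → ℝ} (hY : IsLightTailed Y P) (hYm : AEMeasurable Y P)
    (n : ℕ) : MemLp id n (P.map Y) := by
  rw [memLp_map_measure_iff (by fun_prop) hYm]
  exact memLp_of_mem_interior_integrableExpSet hY.zero_mem_interior n

variable [IsProbabilityMeasure P]

lemma IsLightTailed.deriv_kappa_zero (hX : IsLightTailed (X 1) P) :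
    deriv (kappa X P) 0 = P[X 1] := by
  simp [kappa_eq_cgf, deriv_cgf_zero hX.zero_mem_interior]

lemma IsLightTailed.iteratedDeriv_two_kappa_zero (hX : IsLightTailed (X 1) P)
    (h0 : deriv (kappa X P) 0 = 0) : iteratedDeriv 2 (kappa X P) 0 = P[X 1 ^ 2] := by
  rw [kappa_eq_cgf] at h0 ⊢
  rw [iteratedDeriv_two_cgf hX.zero_mem_interior, h0]
  simp

lemma IsLightTailed.hasDerivAt_charFun_zero (hX : IsLightTailed (X 1) P)
    (hXm : AEMeasurable (X 1) P) :
    HasDerivAt (charFun (P.map (X 1))) (deriv (kappa X P) 0 * Complex.I) 0 := by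
  have := Measure.isProbabilityMeasure_map hXm
  have h := iteratedDeriv_charFun_zero (hX.memLp_map hXm 1)
  rw [iteratedDeriv_one, integral_map hXm (by fun_prop)] at h
  have hd : DifferentiableAt ℝ (charFun (P.map (X 1))) 0 :=
    ((contDiff_charFun (hX.memLp_map hXm 1)).differentiable (by simp)).differentiableAt
  have h' : deriv (charFun (P.map (X 1))) 0 = deriv (kappa X P) 0 * Complex.I := by
    rw [h, hX.deriv_kappa_zero]
    simp [mul_comm]
  exact h' ▸ hd.hasDerivAt

lemma IsLightTailed.charFun_sub_isLittleO (hX : IsLightTailed (X 1) P)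
    (hXm : AEMeasurable (X 1) P) (h0 : deriv (kappa X P) 0 = 0) :
    (fun x : ℝ ↦ charFun (P.map (X 1)) x - (1 - iteratedDeriv 2 (kappa X P) 0 * x ^ 2 / 2))
      =o[𝓝 0] fun x ↦ x ^ 2 := by
  have h2 := hX.memLp_map hXm 2
  have := Measure.isProbabilityMeasure_map hXm
  have ht (x : ℝ) := taylorWithinEval_charFun_two_zero hXm (by simpa using h2) x
  have hE : P[X 1] = 0 := by rw [← hX.deriv_kappa_zero, h0]
  simp only [hE, ← hX.iteratedDeriv_two_kappa_zero h0] at ht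
  have h := taylor_isLittleO_univ (f := charFun (P.map (X 1))) (x₀ := 0) (n := 2)
    (contDiff_charFun h2)
  simp only [ht, sub_zero] at h
  simpa using h

end MGF

/-! ### Self-similarity of inverse stable subordinators -/

section InverseStableSubordinator

variable {Ω : Type*} {mΩ : MeasurableSpace Ω} {P : Measure Ω} [IsProbabilityMeasure P] {ν : ℝ}

/-- Right-continuity of distribution functions absorbs the gap between `x` and `y`. The gap is
needed because `L t ≤ s` and `t < D s` are equivalent only up to the boundary case. -/
lemma MeasureTheory.Measure.eq_of_forall_lt_measureReal_Iic_le {μ μ' : Measure ℝ}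
    [IsProbabilityMeasure μ] [IsProbabilityMeasure μ']
    (h : ∀ x y, x < y → μ.real (Set.Iic x) ≤ μ'.real (Set.Iic y))
    (h' : ∀ x y, x < y → μ'.real (Set.Iic x) ≤ μ.real (Set.Iic y)) : μ = μ' := by
  have key {μ μ' : Measure ℝ} [IsProbabilityMeasure μ] [IsProbabilityMeasure μ']
      (h : ∀ x y, x < y → μ.real (Set.Iic x) ≤ μ'.real (Set.Iic y)) (x : ℝ) :
      cdf μ x ≤ cdf μ' x := by
    have hc := ((cdf μ').right_continuous x).mono Set.Ioi_subset_Ici_self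
    refine ge_of_tendsto hc.tendsto ?_
    filter_upwards [self_mem_nhdsWithin] with y hy
    rw [cdf_eq_real, cdf_eq_real]
    exact h x y hy
  refine Measure.eq_of_cdf _ _ (StieltjesFunction.ext fun x ↦ ?_)
  exact le_antisymm (key h x) (key h' x)

namespace IsStableSubordinator

variable {D : ℝ≥0 → Ω → ℝ}

omit [IsProbabilityMeasure P] in
lemma ae_nonneg (hD : IsStableSubordinator ν D P) (t : ℝ≥0) : ∀ᵐ ω ∂P, 0 ≤ D t ω := by
  filter_upwards [hD.zero, hD.monotone] with ω h0 hm
  exact h0 ▸ hm zero_le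

/-- Self-similarity of stable subordinators. -/
lemma map_rpow_mul (hD : IsStableSubordinator ν D P) (t s : ℝ≥0) :
    P.map (D (t ^ ν * s)) = P.map (fun ω ↦ t * D s ω) := by
  refine map_eq_of_mgf_eqOn_nonpos (hD.measurable _).aemeasurable
    ((hD.measurable _).const_mul _).aemeasurable (hD.ae_nonneg _) ?_ fun θ hθ ↦ ?_
  · filter_upwards [hD.ae_nonneg s] with ω hω
    positivity
  -- Both Laplace exponents equal `t ^ ν * s * (-θ) ^ ν`.
  · rw [mgf_const_mul, hD.laplace _ _ hθ,
      hD.laplace s (t * θ) (mul_nonpos_of_nonneg_of_nonpos t.coe_nonneg hθ),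
      ← mul_neg (t : ℝ) θ, Real.mul_rpow t.coe_nonneg (neg_nonneg.2 hθ)]
    push_cast
    ring_nf

/-- Chernoff's bound at `θ = -1` for `D n`, with `n → ∞`. It makes the set defining the inverse
nonempty, which matters because `sInf ∅ = 0` in `ℝ≥0`. -/
lemma ae_exists_lt (hD : IsStableSubordinator ν D P) (t : ℝ) : ∀ᵐ ω ∂P, ∃ s, t < D s ω := by
  have hbound (n : ℕ) : P.real {ω | ∀ s, D s ω ≤ t} ≤ Real.exp (t - n) := by
    have h := measure_le_le_exp_mul_mgf (μ := P) (X := D n) (t := -1) t (by norm_num)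
      (by
        have := hD.laplace n (-1) (by norm_num)
        exact mgf_pos_iff.1 (this ▸ Real.exp_pos _))
    rw [hD.laplace _ _ (by norm_num), ← Real.exp_add] at h
    refine (measureReal_mono fun ω (hω : ∀ s, D s ω ≤ t) ↦ hω n).trans (h.trans_eq ?_)
    simp [sub_eq_add_neg]
  have hlim : Tendsto (fun n : ℕ ↦ Real.exp (t - n)) atTop (𝓝 0) :=
    Real.tendsto_exp_atBot.comp
      (tendsto_atBot_add_const_left _ t (tendsto_neg_atTop_atBot.comp tendsto_natCast_atTop_atTop))
  have h0 := ge_of_tendsto' hlim hbound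
  rw [ae_iff]
  simpa [measureReal_eq_zero_iff] using h0.antisymm measureReal_nonneg

end IsStableSubordinator

namespace IsInverseStableSubordinator

variable {L : ℝ≥0 → Ω → ℝ≥0}

/-- By monotonicity of `D`, `{L t < s} ⊆ {t < D s} ⊆ {L t ≤ s}` almost surely. At `s = t ^ ν * y`
the middle event has a probability independent of `t`, so it links the times `t` and `t'`. -/
lemma measureReal_div_rpow_le (hL : IsInverseStableSubordinator ν L P) {t t' : ℝ≥0}
    (ht : 0 < t) (ht' : 0 < t') {x y : ℝ} (hxy : x < y) :
    P.real {ω | ((L t ω / t ^ ν : ℝ≥0) : ℝ) ≤ x} ≤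
      P.real {ω | ((L t' ω / t' ^ ν : ℝ≥0) : ℝ) ≤ y} := by
  obtain ⟨D, hD, hLD⟩ := hL.exists_eq_sInf
  rcases lt_or_ge x 0 with hx | hx
  · have : {ω | ((L t ω / t ^ ν : ℝ≥0) : ℝ) ≤ x} = ∅ := by
      ext ω
      simpa only [Set.mem_ofPred_eq, Set.mem_empty_iff_false, iff_false, not_le] using
        hx.trans_le (NNReal.coe_nonneg _)
    rw [this, measureReal_empty]
    exact measureReal_nonneg
  lift x to ℝ≥0 using hx
  lift y to ℝ≥0 using (NNReal.coe_nonneg _).trans hxy.le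
  simp only [NNReal.coe_le_coe]
  rw [NNReal.coe_lt_coe] at hxy
  have hD_eq {r : ℝ≥0} (hr : 0 < r) :
      P.real {ω | (r : ℝ) < D (r ^ ν * y) ω} = P.real {ω | 1 < D y ω} := by
    have h := congrArg (fun μ ↦ μ.real (Set.Ioi (r : ℝ))) (hD.map_rpow_mul r y)
    rw [map_measureReal_apply (hD.measurable _) measurableSet_Ioi,
      map_measureReal_apply ((hD.measurable _).const_mul _) measurableSet_Ioi] at h
    refine h.trans (congrArg _ (Set.ext fun ω ↦ ?_))
    have : (0 : ℝ) < r := hr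
    simp [this]
  calc P.real {ω | L t ω / t ^ ν ≤ x}
      ≤ P.real {ω | (t : ℝ) < D (t ^ ν * y) ω} := by
        refine ENNReal.toReal_mono (measure_ne_top _ _) (measure_mono_ae ?_)
        filter_upwards [hLD, hD.monotone, hD.ae_exists_lt t] with ω hω hm hne hle
        have hlt : L t ω < t ^ ν * y := by
          rw [mul_comm, ← div_lt_iff₀ (NNReal.rpow_pos ht)]
          exact lt_of_le_of_lt hle hxy
        rw [hω t] at hlt
        obtain ⟨s, hs, hsy⟩ := exists_lt_of_csInf_lt hne hlt
        exact lt_of_lt_of_le hs (hm hsy.le)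
    _ = P.real {ω | (t' : ℝ) < D (t' ^ ν * y) ω} := by rw [hD_eq ht, hD_eq ht']
    _ ≤ P.real {ω | L t' ω / t' ^ ν ≤ y} := by
        refine ENNReal.toReal_mono (measure_ne_top _ _) (measure_mono_ae ?_)
        filter_upwards [hLD] with ω hω hlt
        change L t' ω / t' ^ ν ≤ y
        rw [div_le_iff₀ (NNReal.rpow_pos ht'), hω t', mul_comm]
        exact csInf_le (OrderBot.bddBelow _) hlt

/-- Self-similarity of inverse stable subordinators. -/
lemma identDistrib_rpow_mul (hL : IsInverseStableSubordinator ν L P) {t : ℝ≥0}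
    (ht : 0 < t) : IdentDistrib (L t) (fun ω ↦ t ^ ν * L 1 ω) P P := by
  have hm (r : ℝ≥0) : Measurable fun ω ↦ ((L r ω / r ^ ν : ℝ≥0) : ℝ) :=
    ((hL.measurable r).div_const _).coe_nnreal_real
  have hle {r r' : ℝ≥0} (hr : 0 < r) (hr' : 0 < r') (x y : ℝ) (hxy : x < y) :
      (P.map fun ω ↦ ((L r ω / r ^ ν : ℝ≥0) : ℝ)).real (Set.Iic x) ≤
        (P.map fun ω ↦ ((L r' ω / r' ^ ν : ℝ≥0) : ℝ)).real (Set.Iic y) := by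
    rw [map_measureReal_apply (hm _) measurableSet_Iic,
      map_measureReal_apply (hm _) measurableSet_Iic]
    exact hL.measureReal_div_rpow_le hr hr' hxy
  have hprob (r : ℝ≥0) := Measure.isProbabilityMeasure_map (μ := P) (hm r).aemeasurable
  have hid : IdentDistrib (fun ω ↦ ((L t ω / t ^ ν : ℝ≥0) : ℝ))
      (fun ω ↦ ((L 1 ω / 1 ^ ν : ℝ≥0) : ℝ)) P P :=
    ⟨(hm t).aemeasurable, (hm 1).aemeasurable, Measure.eq_of_forall_lt_measureReal_Iic_le
      (hle ht one_pos) (hle one_pos ht)⟩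
  convert hid.comp (u := fun y ↦ t ^ ν * y.toNNReal) (by fun_prop) using 1
  · ext ω
    rw [Function.comp_apply, Real.toNNReal_coe, mul_div_cancel₀ _ (NNReal.rpow_pos ht).ne']
  · ext ω
    simp

lemma identDistrib_pi_rpow_mul {ι : Type*} [Fintype ι] {L : ι → ℝ≥0 → Ω → ℝ≥0}
    (hL : ∀ j, IsInverseStableSubordinator ν (L j) P)
    (hind : iIndepFun (fun j ω t ↦ (L j t ω : ℝ)) P) {t : ℝ≥0} (ht : 0 < t) :
    IdentDistrib (fun ω j ↦ L j t ω) (fun ω j ↦ t ^ ν * L j 1 ω) P P := by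
  have hind' (r : ℝ≥0) : iIndepFun (fun j ↦ L j r) P := by
    simpa [Function.comp_def] using
      hind.comp (fun _ p ↦ (p r).toNNReal) fun _ ↦ (measurable_pi_apply r).real_toNNReal
  have hind₁ : iIndepFun (fun j ω ↦ t ^ ν * L j 1 ω) P :=
    (hind' 1).comp (fun _ y ↦ t ^ ν * y) fun _ ↦ by fun_prop
  have hm (r : ℝ≥0) (j : ι) := (hL j).measurable r
  refine ⟨(measurable_pi_lambda _ (hm t)).aemeasurable,
    (measurable_pi_lambda _ fun j ↦ (hm 1 j).const_mul _).aemeasurable, ?_⟩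
  rw [(hind' t).map_fun_eq_pi_map fun j ↦ (hm t j).aemeasurable,
    hind₁.map_fun_eq_pi_map fun j ↦ ((hm 1 j).const_mul _).aemeasurable]
  simp_rw [fun j ↦ ((hL j).identDistrib_rpow_mul ht).map_eq]

end IsInverseStableSubordinator

end InverseStableSubordinator

/-! ### Lévy processes at independent random times -/

section IndependentTimes

/-- The point of the grid `{(m + 1) / (n + 1) : m ∈ ℕ}` next to the right of `u`. -/
noncomputable def nextGridPoint (n : ℕ) (u : ℝ≥0) : ℝ≥0 := (⌊(n + 1) * u⌋₊ + 1) / (n + 1)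

lemma lt_nextGridPoint (n : ℕ) (u : ℝ≥0) : u < nextGridPoint n u := by
  rw [nextGridPoint, lt_div_iff₀ (by positivity), mul_comm]
  exact Nat.lt_floor_add_one _

lemma nextGridPoint_le (n : ℕ) (u : ℝ≥0) : nextGridPoint n u ≤ u + 1 / (n + 1) := by
  rw [nextGridPoint, add_div]
  gcongr
  rw [div_le_iff₀ (by positivity), mul_comm]
  exact Nat.floor_le zero_le

lemma tendsto_nextGridPoint (u : ℝ≥0) :
    Tendsto (fun n ↦ nextGridPoint n u) atTop (𝓝[≥] u) := by
  refine tendsto_nhdsWithin_iff.2 ⟨?_, .of_forall fun n ↦ (lt_nextGridPoint n u).le⟩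
  refine tendsto_of_tendsto_of_tendsto_of_le_of_le tendsto_const_nhds ?_
    (fun n ↦ (lt_nextGridPoint n u).le) (fun n ↦ nextGridPoint_le n u)
  simpa using tendsto_one_div_add_atTop_nhds_zero_nat (𝕜 := ℝ≥0) |>.const_add u

/-- Evaluation of a path at a variable time is not measurable for the product σ-algebra; on a grid
only countably many times are read. Right-continuity later removes the grid. -/
lemma measurable_eval_nextGridPoint (n : ℕ) :
    Measurable fun p : (ℝ≥0 → ℝ) × ℝ≥0 ↦ p.1 (nextGridPoint n p.2) := by
  have h : Measurable fun p : (ℝ≥0 → ℝ) × ℕ ↦ p.1 ((p.2 + 1) / (n + 1)) :=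
    measurable_from_prod_countable_left fun m ↦ measurable_pi_apply (((m : ℝ≥0) + 1) / (n + 1))
  exact h.comp (measurable_fst.prodMk (Nat.measurable_floor.comp (measurable_snd.const_mul _)))

variable {Ω : Type*} {mΩ : MeasurableSpace Ω} {P : Measure Ω}

lemma ProbabilityTheory.IndepFun.integral_comp_prodMk [IsFiniteMeasure P] {β γ : Type*}
    [MeasurableSpace β] [MeasurableSpace γ] {A : Ω → β} {B : Ω → γ} (h : IndepFun A B P)
    (hA : AEMeasurable A P) (hB : AEMeasurable B P) {F : β × γ → ℂ} (hF : Measurable F) {C : ℝ}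
    (hC : ∀ p, ‖F p‖ ≤ C) :
    ∫ ω, F (A ω, B ω) ∂P = ∫ ω', ∫ ω, F (A ω, B ω') ∂P ∂P := by
  have hint : Integrable F ((P.map A).prod (P.map B)) :=
    .of_bound hF.aestronglyMeasurable C (.of_forall hC)
  rw [← integral_map (φ := fun ω ↦ (A ω, B ω)) (hA.prodMk hB) hF.aestronglyMeasurable,
    (indepFun_iff_map_prod_eq_prod_map_map hA hB).1 h, integral_prod_symm _ hint,
    integral_map hB hint.integral_prod_right.aestronglyMeasurable]
  refine integral_congr_ae (.of_forall fun ω' ↦ ?_)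
  exact integral_map hA (hF.comp (measurable_id.prodMk measurable_const)).aestronglyMeasurable

namespace IsLevyProcess

variable {X : ℝ≥0 → Ω → ℝ} {U : Ω → ℝ≥0}

lemma ae_tendsto_nextGridPoint (hX : IsLevyProcess X P) :
    ∀ᵐ ω ∂P, ∀ u, Tendsto (fun n ↦ X (nextGridPoint n u) ω) atTop (𝓝 (X u ω)) := by
  filter_upwards [hX.cadlag] with ω hω u
  exact (hω u).1.tendsto.comp (tendsto_nextGridPoint u)

lemma aemeasurable_timeChange (hX : IsLevyProcess X P) (hU : Measurable U) :
    AEMeasurable (fun ω ↦ X (U ω) ω) P := by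
  refine aemeasurable_of_tendsto_metrizable_ae atTop
    (f := fun n ω ↦ X (nextGridPoint n (U ω)) ω) (fun n ↦ ?_) ?_
  · exact ((measurable_eval_nextGridPoint n).comp
      ((measurable_pi_lambda _ hX.measurable).prodMk hU)).aemeasurable
  · filter_upwards [hX.ae_tendsto_nextGridPoint] with ω hω using hω _

lemma tendsto_charFun_map_nextGridPoint [IsProbabilityMeasure P] (hX : IsLevyProcess X P)
    (u : ℝ≥0) (x : ℝ) :
    Tendsto (fun n ↦ charFun (P.map (X (nextGridPoint n u))) x) atTop
      (𝓝 (charFun (P.map (X u)) x)) := by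
  simp_rw [hX.charFun_map_apply]
  refine tendsto_integral_of_dominated_convergence (fun _ ↦ 1) (fun n ↦ ?_) (integrable_const _)
    (fun n ↦ .of_forall fun ω ↦ ?_) ?_
  · have := hX.measurable (nextGridPoint n u)
    fun_prop
  · rw [← Complex.ofReal_mul, Complex.norm_exp_ofReal_mul_I]
  · filter_upwards [hX.ae_tendsto_nextGridPoint] with ω hω
    have hc : Continuous fun y : ℝ ↦ Complex.exp (x * y * Complex.I) := by fun_prop
    exact (hc.tendsto _).comp (hω u)

lemma measurable_charFun_map [IsProbabilityMeasure P] (hX : IsLevyProcess X P) (x : ℝ) :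
    Measurable fun u ↦ charFun (P.map (X u)) x := by
  refine measurable_of_tendsto_metrizable (f := fun n u ↦ charFun (P.map (X (nextGridPoint n u))) x)
    (fun n ↦ ?_) (tendsto_pi_nhds.2 fun u ↦ hX.tendsto_charFun_map_nextGridPoint u x)
  have h : Measurable fun m : ℕ ↦ charFun (P.map (X ((m + 1) / (n + 1)))) x := measurable_from_nat
  exact h.comp (Nat.measurable_floor.comp (measurable_id.const_mul _))

/-- Independent Lévy processes at independent random times: the characteristic function is
obtained by conditioning on the times. -/
theorem integral_prod_exp_timeChange [IsProbabilityMeasure P] {ι : Type*} [Fintype ι]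
    {S : ι → ℝ≥0 → Ω → ℝ} {U : ι → Ω → ℝ≥0} (hS : ∀ i, IsLevyProcess (S i) P)
    (hU : ∀ i, Measurable (U i)) (hSi : iIndepFun (fun i ω t ↦ S i t ω) P)
    (hSU : IndepFun (fun ω i t ↦ S i t ω) (fun ω i ↦ U i ω) P) (x : ι → ℝ) :
    ∫ ω, ∏ i, Complex.exp (x i * S i (U i ω) ω * Complex.I) ∂P =
      ∫ ω, ∏ i, charFun (P.map (S i (U i ω))) (x i) ∂P := by
  have hpath (i : ι) : Measurable fun ω t ↦ S i t ω := measurable_pi_lambda _ (hS i).measurable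
  have hpaths : Measurable fun ω i t ↦ S i t ω := measurable_pi_lambda _ hpath
  have hUm : Measurable fun ω i ↦ U i ω := measurable_pi_lambda _ hU
  let G (n : ℕ) (p : (ι → ℝ≥0 → ℝ) × (ι → ℝ≥0)) : ℂ :=
    ∏ i, Complex.exp (x i * p.1 i (nextGridPoint n (p.2 i)) * Complex.I)
  have hGm (n : ℕ) : Measurable (G n) := by
    refine Finset.measurable_fun_prod _ fun i _ ↦ ?_
    have : Measurable fun p : (ι → ℝ≥0 → ℝ) × (ι → ℝ≥0) ↦ p.1 i (nextGridPoint n (p.2 i)) :=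
      (measurable_eval_nextGridPoint n).comp (f := fun p : (ι → ℝ≥0 → ℝ) × (ι → ℝ≥0) ↦ (p.1 i, p.2 i))
        (((measurable_pi_apply i).comp measurable_fst).prodMk
          ((measurable_pi_apply i).comp measurable_snd))
    fun_prop
  have hGnorm (n : ℕ) (p) : ‖G n p‖ = 1 := by
    simp only [G, norm_prod]
    refine Finset.prod_eq_one fun i _ ↦ ?_
    rw [← Complex.ofReal_mul, Complex.norm_exp_ofReal_mul_I]
  -- Fubini freezes the times, then independence of the `S i` factors the inner integral.
  have hcond (n : ℕ) : ∫ ω, G n (fun i t ↦ S i t ω, fun i ↦ U i ω) ∂P =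
      ∫ ω, ∏ i, charFun (P.map (S i (nextGridPoint n (U i ω)))) (x i) ∂P := by
    rw [hSU.integral_comp_prodMk hpaths.aemeasurable hUm.aemeasurable (hGm n)
      fun p ↦ (hGnorm n p).le]
    refine integral_congr_ae (.of_forall fun ω' ↦ ?_)
    refine (hSi.integral_fun_prod_comp (f := fun i p ↦
      Complex.exp (x i * p (nextGridPoint n (U i ω')) * Complex.I))
      (fun i ↦ (hpath i).aemeasurable) fun i ↦ ?_).trans ?_
    · have : Measurable fun p : ℝ≥0 → ℝ ↦ p (nextGridPoint n (U i ω')) := measurable_pi_apply _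
      exact Measurable.aestronglyMeasurable (by fun_prop)
    · exact Finset.prod_congr rfl fun i _ ↦ ((hS i).charFun_map_apply _ _).symm
  -- Refining the grid from the right, both sides converge by dominated convergence.
  refine tendsto_nhds_unique
    (tendsto_integral_of_dominated_convergence
      (F := fun n ω ↦ G n (fun i t ↦ S i t ω, fun i ↦ U i ω)) (fun _ ↦ 1)
      (fun n ↦ ((hGm n).comp (hpaths.prodMk hUm)).aestronglyMeasurable) (integrable_const _)
      (fun n ↦ .of_forall fun ω ↦ (hGnorm n _).le) ?_)
    ((tendsto_integral_of_dominated_convergence (fun _ ↦ 1) (fun n ↦ ?_) (integrable_const _)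
      (fun n ↦ .of_forall fun ω ↦ ?_) ?_).congr fun n ↦ (hcond n).symm)
  · filter_upwards [ae_all_iff.2 fun i ↦ (hS i).ae_tendsto_nextGridPoint] with ω hω
    refine tendsto_finsetProd _ fun i _ ↦ ?_
    have hc : Continuous fun y : ℝ ↦ Complex.exp (x i * y * Complex.I) := by fun_prop
    exact (hc.tendsto _).comp (hω i (U i ω))
  · refine (Finset.measurable_fun_prod _ fun i _ ↦ ?_).aestronglyMeasurable
    have h : Measurable fun m : ℕ ↦ charFun (P.map (S i ((m + 1) / (n + 1)))) (x i) :=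
      measurable_from_nat
    exact h.comp (Nat.measurable_floor.comp ((hU i).const_mul _))
  · rw [norm_prod]
    refine Finset.prod_le_one (fun _ _ ↦ norm_nonneg _) fun i _ ↦ ?_
    have := Measure.isProbabilityMeasure_map (μ := P)
      ((hS i).measurable (nextGridPoint n (U i ω))).aemeasurable
    exact norm_charFun_le_one _
  · exact .of_forall fun ω ↦ tendsto_finsetProd _ fun i _ ↦
      (hS i).tendsto_charFun_map_nextGridPoint _ _

end IsLevyProcess

end IndependentTimes

/-! ### Convergence of the scaled vectors -/

section ScaledTimeChange

variable {Ω Ω' : Type*} {mΩ : MeasurableSpace Ω} {mΩ' : MeasurableSpace Ω'} {P : Measure Ω}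
  {P' : Measure Ω'} [IsProbabilityMeasure P] [IsProbabilityMeasure P']

lemma MeasureTheory.tendstoInDistribution_of_tendsto_charFun {ι E : Type*} [NormedAddCommGroup E]
    [InnerProductSpace ℝ E] [FiniteDimensional ℝ E] [MeasurableSpace E] [BorelSpace E]
    {l : Filter ι} [l.IsCountablyGenerated] {X : ι → Ω → E} {Y : Ω' → E}
    (hX : ∀ i, AEMeasurable (X i) P) (hY : AEMeasurable Y P')
    (h : ∀ ξ, Tendsto (fun i ↦ charFun (P.map (X i)) ξ) l (𝓝 (charFun (P'.map Y) ξ))) :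
    TendstoInDistribution X l Y (fun _ ↦ P) P' where
  forall_aemeasurable := hX
  aemeasurable_limit := hY
  tendsto := tendsto_of_seq_tendsto fun _ hu ↦
    ProbabilityMeasure.tendsto_of_tendsto_charFun fun ξ ↦ (h ξ).comp hu

omit [IsProbabilityMeasure P] in
lemma charFun_map_toLp {ι : Type*} [Fintype ι] {X : ι → Ω → ℝ}
    (hX : ∀ i, AEMeasurable (X i) P) (ξ : EuclideanSpace ℝ ι) :
    charFun (P.map fun ω ↦ (WithLp.toLp 2 fun i ↦ X i ω : EuclideanSpace ℝ ι)) ξ =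
      ∫ ω, ∏ i, Complex.exp (ξ i * X i ω * Complex.I) ∂P := by
  have hm : AEMeasurable (fun ω ↦ (WithLp.toLp 2 fun i ↦ X i ω : EuclideanSpace ℝ ι)) P :=
    (WithLp.measurable_toLp 2 _).comp_aemeasurable (aemeasurable_pi_lambda _ hX)
  rw [charFun_apply, integral_map hm (by fun_prop)]
  refine integral_congr_ae (.of_forall fun ω ↦ ?_)
  simp only
  rw [← Complex.exp_sum, ← Finset.sum_mul, PiLp.inner_apply]
  simp

section Scaling

variable {S : ℝ≥0 → Ω → ℝ}

lemma tendsto_coe_rpow_mul_atTop {β : ℝ} (hβ : β < 0) (x : ℝ) :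
    Tendsto (fun T : ℝ≥0 ↦ (T : ℝ) ^ β * x) atTop (𝓝 0) := by
  have h := (tendsto_rpow_neg_atTop (neg_pos.2 hβ)).comp
    (NNReal.tendsto_coe_atTop.2 tendsto_id)
  simpa [Function.comp_def] using h.mul_const x

/-- Since `β * p = -1`, `T * (T ^ β * x) ^ p` is the constant `x ^ p`. The cases `p = 2` and `p = 1`
kill the Taylor remainders in the two regimes. -/
lemma tendsto_mul_of_isLittleO_pow {g : ℝ → ℂ} {p : ℕ} (hg : g =o[𝓝 0] fun x ↦ x ^ p) {β : ℝ}
    (hβ : β < 0) (hβp : β * p = -1) (x : ℝ) :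
    Tendsto (fun T : ℝ≥0 ↦ ((T : ℝ) : ℂ) * g ((T : ℝ) ^ β * x)) atTop (𝓝 0) := by
  have h := (Asymptotics.isBigO_refl (fun T : ℝ≥0 ↦ ((T : ℝ) : ℂ)) atTop).mul_isLittleO
    (Complex.isLittleO_ofReal_right.2 (hg.comp_tendsto (tendsto_coe_rpow_mul_atTop hβ x)))
  refine (h.trans_isBigO (k := fun _ : ℝ≥0 ↦ (1 : ℂ)) ?_).tendsto_zero_of_tendsto
    tendsto_const_nhds
  refine (tendsto_const_nhds (x := ((x ^ p : ℝ) : ℂ))).congr' ?_ |>.isBigO_one ℂ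
  filter_upwards [eventually_gt_atTop 0] with T hT
  have hT' : (0 : ℝ) < T := hT
  rw [Function.comp_apply, mul_pow, ← Real.rpow_mul_natCast hT'.le, hβp, Real.rpow_neg_one,
    ← Complex.ofReal_mul, ← mul_assoc, mul_inv_cancel₀ hT'.ne', one_mul]

lemma IsLightTailed.tendsto_mul_charFun_sub_one_of_deriv_eq_zero (hS : IsLightTailed (S 1) P)
    (hSm : AEMeasurable (S 1) P) (h0 : deriv (kappa S P) 0 = 0) (x : ℝ) :
    Tendsto (fun T : ℝ≥0 ↦ ((T : ℝ) : ℂ) *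
        (charFun (P.map (S 1)) ((T : ℝ) ^ (-(1 / 2) : ℝ) * x) - 1)) atTop
      (𝓝 (-(iteratedDeriv 2 (kappa S P) 0 * x ^ 2 / 2))) := by
  have h := tendsto_mul_of_isLittleO_pow (hS.charFun_sub_isLittleO hSm h0) (β := -(1 / 2))
    (by norm_num) (by norm_num) x
  have h' := h.add_const (-(iteratedDeriv 2 (kappa S P) 0 * x ^ 2 / 2) : ℂ)
  rw [zero_add] at h'
  refine h'.congr' ?_
  filter_upwards [eventually_gt_atTop 0] with T hT
  have hT' : (0 : ℝ) < T := hT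
  have hsq : ((T : ℝ) : ℂ) * ((((T : ℝ) ^ (-(1 / 2) : ℝ) : ℝ) : ℂ)) ^ 2 = 1 := by
    rw [← Complex.ofReal_pow, ← Real.rpow_mul_natCast hT'.le, ← Complex.ofReal_mul]
    norm_num [Real.rpow_neg_one, hT'.ne']
  push_cast at hsq ⊢
  linear_combination (iteratedDeriv 2 (kappa S P) 0 * x ^ 2 / 2 : ℂ) * hsq

lemma IsLightTailed.tendsto_mul_charFun_sub_one (hS : IsLightTailed (S 1) P)
    (hSm : AEMeasurable (S 1) P) (x : ℝ) :
    Tendsto (fun T : ℝ≥0 ↦ ((T : ℝ) : ℂ) *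
        (charFun (P.map (S 1)) ((T : ℝ) ^ (-1 : ℝ) * x) - 1)) atTop
      (𝓝 (x * deriv (kappa S P) 0 * Complex.I)) := by
  have := Measure.isProbabilityMeasure_map hSm
  have ho := (hS.hasDerivAt_charFun_zero hSm).isLittleO
  simp only [charFun_zero, sub_zero, probReal_univ, Complex.ofReal_one] at ho
  have h := tendsto_mul_of_isLittleO_pow (p := 1) (by simpa using ho) (β := -1)
    (by norm_num) (by norm_num) x
  have h' := h.add_const (x * deriv (kappa S P) 0 * Complex.I : ℂ)
  rw [zero_add] at h'
  refine h'.congr' ?_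
  filter_upwards [eventually_gt_atTop 0] with T hT
  have hT' : ((T : ℝ) : ℂ) ≠ 0 := by simpa using hT.ne'
  rw [Real.rpow_neg_one]
  push_cast at hT' ⊢
  field_simp
  ring

end Scaling

section TimeChange

variable {h k : ℕ} {S : Fin h → ℝ≥0 → Ω → ℝ} {L : Fin k → ℝ≥0 → Ω → ℝ≥0}
  {c : Fin h → Fin k → ℝ≥0} {ν : ℝ}

omit [IsProbabilityMeasure P] in
lemma indepFun_timeChange (hS : ∀ i t, Measurable (S i t)) (hL : ∀ j t, Measurable (L j t))
    (hindep : iIndepFun (Sum.elim (fun i ω t ↦ S i t ω) (fun j ω t ↦ (L j t ω : ℝ)) :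
      Fin h ⊕ Fin k → Ω → ℝ≥0 → ℝ) P) (t : ℝ≥0) :
    IndepFun (fun ω i t ↦ S i t ω) (fun ω i ↦ ∑ j, c i j * L j t ω) P := by
  have hm (x : Fin h ⊕ Fin k) : Measurable ((Sum.elim (fun i ω t ↦ S i t ω)
      (fun j ω t ↦ (L j t ω : ℝ)) : Fin h ⊕ Fin k → Ω → ℝ≥0 → ℝ) x) := by
    rcases x with i | j
    · exact measurable_pi_lambda _ (hS i)
    · exact measurable_pi_lambda _ fun t ↦ (hL j t).coe_nnreal_real
  have hdisj : Disjoint (Finset.univ.map (⟨Sum.inl, Sum.inl_injective⟩ : Fin h ↪ Fin h ⊕ Fin k))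
      (Finset.univ.map ⟨Sum.inr, Sum.inr_injective⟩) := by
    simp [Finset.disjoint_left]
  have hST := hindep.indepFun_finset _ _ hdisj hm
  have h1 : Measurable fun (f : (Finset.univ.map (⟨Sum.inl, Sum.inl_injective⟩ :
      Fin h ↪ Fin h ⊕ Fin k)) → ℝ≥0 → ℝ) (i : Fin h) ↦ f ⟨Sum.inl i, by simp⟩ := by
    fun_prop
  have h2 : Measurable fun (f : (Finset.univ.map (⟨Sum.inr, Sum.inr_injective⟩ :
      Fin k ↪ Fin h ⊕ Fin k)) → ℝ≥0 → ℝ) (i : Fin h) ↦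
      ∑ j, c i j * (f ⟨Sum.inr j, by simp⟩ t).toNNReal := by
    fun_prop
  simpa [Function.comp_def] using hST.comp h1 h2

omit [IsProbabilityMeasure P] in
lemma aemeasurable_scaledTimeChange (hS : ∀ i, IsLevyProcess (S i) P)
    (hL : ∀ j t, Measurable (L j t)) (α : ℝ) (t : ℝ≥0) :
    AEMeasurable (scaledTimeChange S L c α t) P := by
  refine (WithLp.measurable_toLp 2 _).comp_aemeasurable (aemeasurable_pi_lambda _ fun i ↦ ?_)
  have := (hS i).aemeasurable_timeChange (U := fun ω ↦ ∑ j, c i j * L j t ω) (by fun_prop)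
  exact (this.div_const _).const_mul _

lemma charFun_scaledTimeChange (hν : 0 < ν) (hS : ∀ i, IsLevyProcess (S i) P)
    (hL : ∀ j, IsInverseStableSubordinator ν (L j) P)
    (hindep : iIndepFun (Sum.elim (fun i ω t ↦ S i t ω) (fun j ω t ↦ (L j t ω : ℝ)) :
      Fin h ⊕ Fin k → Ω → ℝ≥0 → ℝ) P) (α : ℝ) {t : ℝ≥0} (ht : 0 < t)
    (ξ : EuclideanSpace ℝ (Fin h)) :
    charFun (P.map (scaledTimeChange S L c α t)) ξ =
      ∫ ω, ∏ i, charFun (P.map (S i (t ^ ν * ∑ j, c i j * L j 1 ω)))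
        (((t ^ ν : ℝ≥0) : ℝ) ^ ((α - 1) / ν) * ξ i) ∂P := by
  have hLm (j t) := (hL j).measurable t
  have hUm (i : Fin h) : Measurable fun ω ↦ ∑ j, c i j * L j t ω := by fun_prop
  have ht' : (0 : ℝ) < t := ht
  have hpow : ((t ^ ν : ℝ≥0) : ℝ) ^ ((α - 1) / ν) = (t : ℝ) ^ α / t := by
    rw [NNReal.coe_rpow, ← Real.rpow_mul ht'.le, mul_div_cancel₀ _ hν.ne', Real.rpow_sub_one ht'.ne']
  have hg : Measurable fun v : Fin k → ℝ≥0 ↦ ∏ i, charFun (P.map (S i (∑ j, c i j * v j)))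
      (((t ^ ν : ℝ≥0) : ℝ) ^ ((α - 1) / ν) * ξ i) := by
    refine Finset.measurable_fun_prod _ fun i _ ↦ ((hS i).measurable_charFun_map _).comp ?_
    fun_prop
  -- After conditioning the integrand depends only on the vector of `L j t`, so equality in law is
  -- enough.
  have hid := (IsInverseStableSubordinator.identDistrib_pi_rpow_mul hL
    (hindep.precomp (g := Sum.inr) Sum.inr_injective) ht).comp hg
  calc charFun (P.map (scaledTimeChange S L c α t)) ξ
      = ∫ ω, ∏ i, Complex.exp ((((t ^ ν : ℝ≥0) : ℝ) ^ ((α - 1) / ν) * ξ i : ℝ) *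
          S i (∑ j, c i j * L j t ω) ω * Complex.I) ∂P := by
        refine (charFun_map_toLp (fun i ↦ ?_) ξ).trans ?_
        · exact (((hS i).aemeasurable_timeChange (hUm i)).div_const _).const_mul _
        · simp_rw [hpow]
          push_cast
          congr! 5
          ring
    _ = ∫ ω, ∏ i, charFun (P.map (S i (∑ j, c i j * L j t ω)))
          (((t ^ ν : ℝ≥0) : ℝ) ^ ((α - 1) / ν) * ξ i) ∂P :=
        IsLevyProcess.integral_prod_exp_timeChange hS hUm
          (hindep.precomp (g := Sum.inl) Sum.inl_injective)
          (indepFun_timeChange (fun i ↦ (hS i).measurable) hLm hindep t) _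
    _ = _ := by
        rw [show (∫ ω, ∏ i, charFun (P.map (S i (∑ j, c i j * L j t ω)))
          (((t ^ ν : ℝ≥0) : ℝ) ^ ((α - 1) / ν) * ξ i) ∂P) = _ from hid.integral_eq]
        simp only [Function.comp_apply, Finset.mul_sum, mul_left_comm]

lemma tendsto_charFun_scaledTimeChange (hν : 0 < ν) (hS : ∀ i, IsLevyProcess (S i) P)
    (hL : ∀ j, IsInverseStableSubordinator ν (L j) P)
    (hindep : iIndepFun (Sum.elim (fun i ω t ↦ S i t ω) (fun j ω t ↦ (L j t ω : ℝ)) :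
      Fin h ⊕ Fin k → Ω → ℝ≥0 → ℝ) P) {α β : ℝ} (hβ : β < 0) (hαβ : α - 1 = β * ν)
    (ξ : EuclideanSpace ℝ (Fin h)) {w : Fin h → ℂ}
    (hw : ∀ i, Tendsto (fun T : ℝ≥0 ↦ ((T : ℝ) : ℂ) *
      (charFun (P.map (S i 1)) ((T : ℝ) ^ β * ξ i) - 1)) atTop (𝓝 (w i))) :
    Tendsto (fun t ↦ charFun (P.map (scaledTimeChange S L c α t)) ξ) atTop
      (𝓝 (∫ ω, ∏ i, Complex.exp ((∑ j, c i j * L j 1 ω : ℝ≥0) * w i) ∂P)) := by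
  have hLm (j t) := (hL j).measurable t
  have hβ' : (α - 1) / ν = β := by rw [hαβ, mul_div_cancel_right₀ _ hν.ne']
  have hlim : Tendsto (fun T : ℝ≥0 ↦ ∫ ω, ∏ i, charFun (P.map (S i (T * ∑ j, c i j * L j 1 ω)))
      ((T : ℝ) ^ β * ξ i) ∂P) atTop
      (𝓝 (∫ ω, ∏ i, Complex.exp ((∑ j, c i j * L j 1 ω : ℝ≥0) * w i) ∂P)) := by
    refine tendsto_integral_filter_of_dominated_convergence (fun _ ↦ 1) (.of_forall fun T ↦ ?_)
      (.of_forall fun T ↦ .of_forall fun ω ↦ ?_) (integrable_const _) (.of_forall fun ω ↦ ?_)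
    · refine (Finset.measurable_fun_prod _ fun i _ ↦
        ((hS i).measurable_charFun_map _).comp ?_).aestronglyMeasurable
      fun_prop
    · rw [norm_prod]
      refine Finset.prod_le_one (fun _ _ ↦ norm_nonneg _) fun i _ ↦ ?_
      have := Measure.isProbabilityMeasure_map (μ := P)
        ((hS i).measurable (T * ∑ j, c i j * L j 1 ω)).aemeasurable
      exact norm_charFun_le_one _
    · exact tendsto_finsetProd _ fun i _ ↦
        (hS i).tendsto_charFun_map_mul (tendsto_coe_rpow_mul_atTop hβ _) (hw i) _
  have hpow : Tendsto (fun t : ℝ≥0 ↦ t ^ ν) atTop atTop := NNReal.tendsto_rpow_atTop hν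
  refine (hlim.comp hpow).congr' ?_
  filter_upwards [eventually_gt_atTop 0] with t ht
  rw [charFun_scaledTimeChange hν hS hL hindep α ht, hβ']
  rfl

/-- The characteristic function of a mixture of centred normal vectors with independent
coordinates. -/
lemma charFun_map_sqrt_mul_gaussian {κ : Type*} [MeasurableSpace κ] {ι : Type*} [Fintype ι]
    {ℓ : Ω' → κ} {Z : ι → Ω' → ℝ} (hℓ : AEMeasurable ℓ P')
    (hZ : ∀ i, HasLaw (Z i) (gaussianReal 0 1) P') (hZi : iIndepFun Z P')
    (hℓZ : IndepFun ℓ (fun ω' i ↦ Z i ω') P') {v : ι → κ → ℝ} (hv : ∀ i, Measurable (v i))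
    (hv0 : ∀ i x, 0 ≤ v i x) (ξ : EuclideanSpace ℝ ι) :
    charFun (P'.map fun ω' ↦ (WithLp.toLp 2 fun i ↦ √(v i (ℓ ω')) * Z i ω' :
        EuclideanSpace ℝ ι)) ξ =
      ∫ ω', ∏ i, Complex.exp (-(v i (ℓ ω') * ξ i ^ 2 / 2)) ∂P' := by
  have hZm (i : ι) := (hZ i).aemeasurable
  rw [charFun_map_toLp (X := fun i ω' ↦ √(v i (ℓ ω')) * Z i ω')
    fun i ↦ ((hv i).sqrt.comp_aemeasurable hℓ).mul (hZm i)]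
  have hF : Measurable fun p : (ι → ℝ) × κ ↦
      ∏ i, Complex.exp (ξ i * (√(v i p.2) * p.1 i : ℝ) * Complex.I) := by
    fun_prop
  -- Conditionally on `ℓ` the coordinates are independent centred Gaussians with variances `v i`.
  rw [hℓZ.symm.integral_comp_prodMk (aemeasurable_pi_lambda _ hZm) hℓ hF (C := 1) fun p ↦ ?_]
  · refine integral_congr_ae (.of_forall fun ω' ↦ ?_)
    simp only
    rw [hZi.integral_fun_prod_comp (f := fun i z ↦
      Complex.exp (ξ i * (√(v i (ℓ ω')) * z : ℝ) * Complex.I)) hZm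
      fun i ↦ by fun_prop]
    refine Finset.prod_congr rfl fun i _ ↦ ?_
    have hchar := charFun_gaussianReal (μ := 0) (v := 1) (ξ i * √(v i (ℓ ω')))
    rw [← (hZ i).map_eq, charFun_apply_real, integral_map (hZm i) (by fun_prop)] at hchar
    have hsq : ((√(v i (ℓ ω')) : ℝ) : ℂ) ^ 2 = v i (ℓ ω') := by
      rw [← Complex.ofReal_pow, Real.sq_sqrt (hv0 _ _)]
    push_cast at hchar ⊢
    simp only [mul_assoc] at hchar ⊢
    rw [hchar]
    congr 1
    rw [mul_pow, hsq]
    simp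
    ring
  · rw [norm_prod]
    refine (Finset.prod_eq_one fun i _ ↦ ?_).le
    rw [← Complex.ofReal_mul, Complex.norm_exp_ofReal_mul_I]

end TimeChange

end ScaledTimeChange

/-! ### The zero and nonzero drift regimes -/

theorem mainTheorem4 {Ω : Type*} [MeasurableSpace Ω] (P : Measure Ω) [IsProbabilityMeasure P]
    {h k : ℕ} (S : Fin h → ℝ≥0 → Ω → ℝ) (L : Fin k → ℝ≥0 → Ω → ℝ≥0)
    (c : Fin h → Fin k → ℝ≥0) (ν : ℝ)
    (hc : ∀ i j, 0 < c i j)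
    (hν : ν ∈ Set.Ioo (0 : ℝ) 1)
    (hS : ∀ i, IsLevyProcess (S i) P)
    (hS_light : ∀ i, IsLightTailed (S i 1) P)
    (hL : ∀ j, IsInverseStableSubordinator ν (L j) P)
    -- the `h + k` processes `S_1, …, S_h, L_1, …, L_k` are mutually independent
    (hindep : iIndepFun (Sum.elim (fun i ω t ↦ S i t ω) (fun j ω t ↦ (L j t ω : ℝ)) :
      Fin h ⊕ Fin k → Ω → ℝ≥0 → ℝ) P) :
    (driftVector S P = 0 →
      -- `(ℓ_1, …, ℓ_k)` is any copy of `(L_1(1), …, L_k(1))`, on a space that carries the `Z_i`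
      ∀ {Ω' : Type*} [MeasurableSpace Ω'] (P' : Measure Ω') [IsProbabilityMeasure P']
        (ℓ : Fin k → Ω' → ℝ≥0) (Z : Fin h → Ω' → ℝ),
        IdentDistrib (fun ω' j ↦ ℓ j ω') (fun ω j ↦ L j 1 ω) P' P →
        (∀ i, HasLaw (Z i) (gaussianReal 0 1) P') →
        iIndepFun Z P' →
        IndepFun (fun ω' j ↦ ℓ j ω') (fun ω' i ↦ Z i ω') P' →
        TendstoInDistribution (scaledTimeChange S L c (alphaExponent (driftVector S P) ν)) atTop
          (fun ω' ↦ (WithLp.toLp 2 fun i ↦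
            √((∑ j, (c i j : ℝ) * ℓ j ω') * iteratedDeriv 2 (kappa (S i) P) 0) * Z i ω' :
              EuclideanSpace ℝ (Fin h)))
          (fun _ ↦ P) P') ∧
    (driftVector S P ≠ 0 →
      TendstoInDistribution (scaledTimeChange S L c (alphaExponent (driftVector S P) ν)) atTop
        (fun ω ↦ (WithLp.toLp 2 fun i ↦
          driftVector S P i * ∑ j, (c i j : ℝ) * L j 1 ω : EuclideanSpace ℝ (Fin h)))
        (fun _ ↦ P) P) := by
  have hLm (j t) := (hL j).measurable t
  have hSm (i : Fin h) : AEMeasurable (S i 1) P := ((hS i).measurable 1).aemeasurable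
  have hXm := aemeasurable_scaledTimeChange (c := c) hS hLm
  refine ⟨fun hm Ω' _ P' _ ℓ Z hℓ hZ hZi hℓZ ↦ ?_, fun hm ↦ ?_⟩
  · have h0 (i : Fin h) : deriv (kappa (S i) P) 0 = 0 := congrFun hm i
    -- With zero mean this is a second moment; nonnegativity makes the square root below a genuine
    -- standard deviation.
    have hσ (i : Fin h) : 0 ≤ iteratedDeriv 2 (kappa (S i) P) 0 := by
      rw [(hS_light i).iteratedDeriv_two_kappa_zero (h0 i)]
      exact integral_nonneg fun ω ↦ sq_nonneg (S i 1 ω)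
    have hℓm := hℓ.aemeasurable_fst
    have hv (i : Fin h) : Measurable fun x : Fin k → ℝ≥0 ↦
        (∑ j, (c i j : ℝ) * x j) * iteratedDeriv 2 (kappa (S i) P) 0 := by fun_prop
    refine tendstoInDistribution_of_tendsto_charFun (hXm _) ?_ fun ξ ↦ ?_
    · exact (WithLp.measurable_toLp 2 _).comp_aemeasurable (aemeasurable_pi_lambda _ fun i ↦
        ((hv i).sqrt.comp_aemeasurable hℓm).mul (hZ i).aemeasurable)
    · rw [charFun_map_sqrt_mul_gaussian hℓm hZ hZi hℓZ hv
        fun i x ↦ mul_nonneg (Finset.sum_nonneg fun j _ ↦ by positivity) (hσ i)]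
      have hg : Measurable fun x : Fin k → ℝ≥0 ↦ ∏ i, Complex.exp
          (-(((∑ j, (c i j : ℝ) * x j) * iteratedDeriv 2 (kappa (S i) P) 0 : ℝ) * ξ i ^ 2 / 2)) := by
        fun_prop
      have hlim := tendsto_charFun_scaledTimeChange (c := c) hν.1 hS hL hindep (α := 1 - ν / 2)
        (β := -(1 / 2)) (by norm_num) (by ring) ξ fun i ↦
        (hS_light i).tendsto_mul_charFun_sub_one_of_deriv_eq_zero (hSm i) (h0 i) (ξ i)
      rw [alphaExponent, if_pos hm]
      convert hlim using 2
      refine ((hℓ.comp hg).integral_eq).trans (integral_congr_ae (.of_forall fun ω ↦ ?_))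
      refine Finset.prod_congr rfl fun i _ ↦ congrArg _ ?_
      push_cast
      ring
  · refine tendstoInDistribution_of_tendsto_charFun (hXm _) ?_ fun ξ ↦ ?_
    · exact ((WithLp.measurable_toLp 2 _).comp (measurable_pi_lambda _ fun i ↦ by
        fun_prop)).aemeasurable
    -- First-order expansion at scale `T⁻¹`: coordinates with zero drift are covered too, with limit
    -- `0`.
    · have hlim := tendsto_charFun_scaledTimeChange (c := c) hν.1 hS hL hindep (α := 1 - ν)
        (β := -1) (by norm_num) (by ring) ξ fun i ↦
        (hS_light i).tendsto_mul_charFun_sub_one (hSm i) (ξ i)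
      rw [alphaExponent, if_neg hm, charFun_map_toLp fun i ↦ by fun_prop]
      convert hlim using 2
      refine integral_congr_ae (.of_forall fun ω ↦ Finset.prod_congr rfl fun i _ ↦ congrArg _ ?_)
      rw [driftVector]
      push_cast
      ring
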